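/- For positive integers $k,d,n$ let $f_{k,d}(n)$ be the maximal size of a set $A\subseteq\{1,2,\dots,n\}$ such that the equation $$a_1a_2\cdots a_k=x^d$$ has no solution with $a_1,\dots,a_k\in A$ (not necessarily distinct) and $x$ an integer, except trivial solutions. A solution is called trivial if the multiset of the $a_i$'s can be partitioned into $d$-tuples, each of which consists of $d$ copies of the same number. Let $\pi(n)$ denote the number of primes not exceeding $n$. Theorem. We have $$\frac{n^{2/3}}{(\log n)^{4/3}}\ll f_{9,3}(n)-\pi(n)\ll n^{2/3}\log n ;$$ that is, there are absolute constants $c,C>0$ such that for every integer $n\ge 2$ $$c\,\frac{n^{2/3}}{(\log n)^{4/3}}\le f_{9,3}(n)-\pi(n)\le C\,n^{2/3}\log n .$$ -/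

import Mathlib

/-- The multiset `s` can be partitioned into `d`-tuples, each of which consists of `d` copies of
the same number: `s` is the multiset sum of `replicate d a` over the members `a` of some
multiset `t`. A solution of `a₁ ⋯ a_k = x ^ d` is trivial if the multiset of the `aᵢ` is such. -/
def IsTrivialSolution (d : ℕ) (s : Multiset ℕ) : Prop :=
  ∃ t : Multiset ℕ, s = t.bind fun a => Multiset.replicate d a

/-- `γ_{k,d}`: the sets `A` of positive integers such that every solution of
`a₁ ⋯ a_k = x ^ d` with `a₁, …, a_k ∈ A` (repetitions allowed) and `x` an integer is trivial.
The unordered `k`-tuple `a₁, …, a_k` is a multiset `s` with `k` members. -/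
def gammaFamily (k d : ℕ) : Set (Set ℕ) :=
  {A | (∀ a ∈ A, 0 < a) ∧
    ∀ s : Multiset ℕ, s.card = k → (∀ a ∈ s, a ∈ A) →
      (∃ x : ℤ, (s.prod : ℤ) = x ^ d) → IsTrivialSolution d s}

open Classical in
/-- `f_{k,d}(n)`: the maximal size of a set `A ⊆ {1, …, n}` that belongs to `γ_{k,d}`. -/
noncomputable def fMax (k d n : ℕ) : ℕ :=
  ((Finset.Icc 1 n).powerset.filter fun A : Finset ℕ => (A : Set ℕ) ∈ gammaFamily k d).sup
    Finset.card

/-! Both bounds read products `x * y` as edges of a bipartite graph. A solution of `a₁ ⋯ a₉ = x ^ 3`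
among the edges is a weighting of total 9, and it is trivial iff every weight is divisible by 3.

Lower bound: give distinct primes up to `√n` to the `2 r³` points and lines of an incidence
structure over `ZMod r` with `r⁴` flags and no 4- or 6-cycles. Replace these primes by the products
along the flags. The flags whose weight is not divisible by 3 would form a graph of minimum degree
at least 2 and girth at least 8. It meets at least four lines, each of total weight at least 3,
whereas 9 < 12 (`three_dvd_weight`). Chebyshev's estimate and Bertrand's postulate give an `r` with
`r³` of order at least `√n / log n`, and the gain is of order `r⁴`.

Upper bound: conversely, a 4-cycle or a 6-cycle of products in `A` carries a nontrivial solution.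
Let `K = ⌊n^(2/3)⌋`. Members with a prime factor above `K` are edges between primes and integers
below `n^(1/3)`, and the absence of 4-cycles leaves at most `π(n) + K` of them. Every other member
is `u * v` with `u, v ≤ K`. For `u` in a dyadic interval, the absence of 4- and 6-cycles allows
`O(K)` edges (`card_pow_three_le`), and there are `O(log n)` intervals. -/

/-! ### Trivial solutions and weights on incidence structures -/

/-- A multiset splits into `d`-tuples of equal members exactly when `d` divides every
multiplicity. -/
theorem isTrivialSolution_iff {d : ℕ} (s : Multiset ℕ) :
    IsTrivialSolution d s ↔ ∀ a, d ∣ s.count a := by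
  have key : ∀ (t : Multiset ℕ) (b : ℕ),
      (t.bind fun a => Multiset.replicate d a).count b = d * t.count b := by
    intro t b
    induction t using Multiset.induction_on with
    | empty => simp
    | cons a t ih =>
      rw [Multiset.cons_bind, Multiset.count_add, ih, Multiset.count_replicate,
        Multiset.count_cons]
      by_cases h : a = b
      · subst h; simp; ring
      · simp [h, Ne.symm h]
  constructor
  · rintro ⟨t, rfl⟩ a
    rw [key]
    exact dvd_mul_right _ _
  · intro h
    refine ⟨∑ a ∈ s.toFinset, Multiset.replicate (s.count a / d) a, ?_⟩
    ext b
    rw [key, Multiset.count_sum']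
    simp only [Multiset.count_replicate]
    rw [Finset.sum_ite_eq']
    split_ifs with hb
    · exact (Nat.mul_div_cancel' (h b)).symm
    · rw [Multiset.mem_toFinset] at hb
      simpa using hb

/-- In an incidence structure without digons and triangles, a nonnegative integer weight whose sums
over the flags at every point and at every line are multiples of `3`, and whose total is less than
`12`, takes only multiples of `3` as values. -/
theorem three_dvd_weight {P L : Type*} [Fintype P] [Fintype L]
    (I : P → L → Prop)
    (hlin : ∀ p q l m, I p l → I q l → I p m → I q m → p = q ∨ l = m)
    (htri : ∀ p q r l m k, I p l → I q l → I q m → I r m → I r k → I p k →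
      p = q ∨ q = r ∨ r = p ∨ l = m ∨ m = k ∨ k = l)
    (w : P → L → ℕ) (hsupp : ∀ p l, w p l ≠ 0 → I p l)
    (hp : ∀ p, 3 ∣ ∑ l, w p l) (hl : ∀ l, 3 ∣ ∑ p, w p l)
    (htot : ∑ p, ∑ l, w p l < 12) (p : P) (l : L) : 3 ∣ w p l := by
  classical
  by_contra hpl
  have hI : ∀ {p l}, ¬ 3 ∣ w p l → I p l := fun {p l} h =>
    hsupp p l fun h0 => h (h0 ▸ dvd_zero 3)
  have otherL : ∀ {p l}, ¬ 3 ∣ w p l → ∃ m, m ≠ l ∧ ¬ 3 ∣ w p m := by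
    intro p l h
    by_contra! hc
    have hd : 3 ∣ ∑ m ∈ Finset.univ.erase l, w p m :=
      Finset.dvd_sum fun m hm => hc m (Finset.ne_of_mem_erase hm)
    refine h ((Nat.dvd_add_left hd).1 ?_)
    rw [Finset.add_sum_erase _ _ (Finset.mem_univ l)]
    exact hp p
  have otherP : ∀ {p l}, ¬ 3 ∣ w p l → ∃ q, q ≠ p ∧ ¬ 3 ∣ w q l := by
    intro p l h
    by_contra! hc
    have hd : 3 ∣ ∑ q ∈ Finset.univ.erase p, w q l :=
      Finset.dvd_sum fun q hq => hc q (Finset.ne_of_mem_erase hq)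
    refine h ((Nat.dvd_add_left hd).1 ?_)
    rw [Finset.add_sum_erase _ (fun q => w q l) (Finset.mem_univ p)]
    exact hl l
  have three_le : ∀ {p l}, ¬ 3 ∣ w p l → 3 ≤ ∑ q, w q l := by
    intro p l h
    refine Nat.le_of_dvd ?_ (hl l)
    refine lt_of_lt_of_le (Nat.pos_of_ne_zero fun h0 : w p l = 0 => h (h0 ▸ dvd_zero 3))
      (Finset.single_le_sum (f := fun q => w q l) (fun _ _ => Nat.zero_le _) (Finset.mem_univ p))
  -- Grow a path `j, q, l, p, m, r, k` of flags with weight not divisible by 3. A coincidence among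
  -- its lines would close a digon or a triangle.
  obtain ⟨m, hml, hpm⟩ := otherL hpl
  obtain ⟨q, hqp, hql⟩ := otherP hpl
  obtain ⟨r, hrp, hrm⟩ := otherP hpm
  obtain ⟨j, hjl, hqj⟩ := otherL hql
  obtain ⟨k, hkm, hrk⟩ := otherL hrm
  have hjm : j ≠ m := by
    rintro rfl
    rcases hlin _ _ _ _ (hI hpl) (hI hql) (hI hpm) (hI hqj) with h | h
    exacts [hqp h.symm, hml h.symm]
  have hkl : k ≠ l := by
    rintro rfl
    rcases hlin _ _ _ _ (hI hpl) (hI hrk) (hI hpm) (hI hrm) with h | h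
    exacts [hrp h.symm, hml h.symm]
  have hqr : q ≠ r := by
    rintro rfl
    rcases hlin _ _ _ _ (hI hpl) (hI hql) (hI hpm) (hI hrm) with h | h
    exacts [hqp h.symm, hml h.symm]
  have hjk : j ≠ k := by
    rintro rfl
    rcases htri _ _ _ _ _ _ (hI hpl) (hI hql) (hI hqj) (hI hrk) (hI hrm) (hI hpm)
      with h | h | h | h | h | h
    exacts [hqp h.symm, hqr h, hrp h, hjl h.symm, hkm h, hml h]
  have hsum : ∑ i ∈ ({l, m, j, k} : Finset L), ∑ q, w q i ≤ ∑ i, ∑ q, w q i :=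
    Finset.sum_le_sum_of_subset (Finset.subset_univ _)
  rw [Finset.sum_insert (by simp [hml.symm, hjl.symm, hkl.symm]),
    Finset.sum_insert (by simp [hjm.symm, hkm.symm]), Finset.sum_insert (by simp [hjk]),
    Finset.sum_singleton, Finset.sum_comm] at hsum
  have h1 := three_le hpl
  have h2 := three_le hpm
  have h3 := three_le hqj
  have h4 := three_le hrk
  omega

theorem factorization_multiset_prod {s : Multiset ℕ} (hs : ∀ a ∈ s, a ≠ 0) (q : ℕ) :
    s.prod.factorization q = (s.map fun a => a.factorization q).sum := by
  induction s using Multiset.induction_on with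
  | empty => simp
  | cons a s ih =>
    have hs' : ∀ b ∈ s, b ≠ 0 := fun b hb => hs b (Multiset.mem_cons_of_mem hb)
    rw [Multiset.prod_cons, Multiset.map_cons, Multiset.sum_cons, Nat.factorization_mul
      (hs a (Multiset.mem_cons_self a s)) (Multiset.prod_ne_zero fun h => hs' 0 h rfl),
      Finsupp.add_apply, ih hs']

/-- Turns the exponent of a prime in the product into a sum of multiplicities over the flags at its
vertex. -/
theorem sum_map_indicator {ι : Type*} [Fintype ι] (g : ι → ℕ) (s : Multiset ℕ) :
    (s.map fun a => ∑ i, if a = g i then 1 else 0).sum = ∑ i, s.count (g i) := by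
  induction s using Multiset.induction_on with
  | empty => simp
  | cons a s ih =>
    simp only [Multiset.map_cons, Multiset.sum_cons, ih, Multiset.count_cons,
      Finset.sum_add_distrib, add_comm, eq_comm]

/-- Primes, together with the products of two primes along the flags of an incidence structure
without digons and triangles, admit only trivial solutions. -/
theorem mem_gammaFamily_of_incidence {P L : Type*} [Fintype P] [Fintype L]
    (I : P → L → Prop)
    (hlin : ∀ p q l m, I p l → I q l → I p m → I q m → p = q ∨ l = m)
    (htri : ∀ p q r l m k, I p l → I q l → I q m → I r m → I r k → I p k →
      p = q ∨ q = r ∨ r = p ∨ l = m ∨ m = k ∨ k = l)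
    (φ : P → ℕ) (ψ : L → ℕ) (hφ : φ.Injective) (hψ : ψ.Injective)
    (hφp : ∀ p, (φ p).Prime) (hψp : ∀ l, (ψ l).Prime) (hne : ∀ p l, φ p ≠ ψ l)
    (Q : Set ℕ) (hQ : ∀ q ∈ Q, q.Prime) (hQφ : ∀ p, φ p ∉ Q) (hQψ : ∀ l, ψ l ∉ Q) :
    Q ∪ {a | ∃ p l, I p l ∧ a = φ p * ψ l} ∈ gammaFamily 9 3 := by
  classical
  have hpos : ∀ a ∈ Q ∪ {a | ∃ p l, I p l ∧ a = φ p * ψ l}, 0 < a := by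
    rintro a (ha | ⟨p, l, -, rfl⟩)
    · exact (hQ a ha).pos
    · exact Nat.mul_pos (hφp p).pos (hψp l).pos
  refine ⟨hpos, fun s hs hsA ⟨x, hx⟩ => ?_⟩
  have hinj : ∀ {p l q m}, φ p * ψ l = φ q * ψ m → p = q ∧ l = m := by
    intro p l q m h
    have hpq : p = q := by
      have hd : φ p ∣ φ q * ψ m := h ▸ dvd_mul_right _ _
      rcases (hφp p).dvd_mul.1 hd with h' | h'
      · exact hφ ((Nat.prime_dvd_prime_iff_eq (hφp p) (hφp q)).1 h')
      · exact absurd ((Nat.prime_dvd_prime_iff_eq (hφp p) (hψp m)).1 h') (hne p m)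
    subst hpq
    exact ⟨rfl, hψ (Nat.eq_of_mul_eq_mul_left (hφp p).pos h)⟩
  have hcube : s.prod = x.natAbs ^ 3 := by
    have := congrArg Int.natAbs hx
    rwa [Int.natAbs_natCast, Int.natAbs_pow] at this
  have hdvd : ∀ q, 3 ∣ (s.map fun a => a.factorization q).sum := by
    intro q
    rw [← factorization_multiset_prod (fun a ha => (hpos a (hsA a ha)).ne'), hcube,
      Nat.factorization_pow]
    simp
  have hfac : ∀ p l q, (φ p * ψ l).factorization q =
      (if φ p = q then 1 else 0) + (if ψ l = q then 1 else 0) := by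
    intro p l q
    rw [Nat.factorization_mul (hφp p).ne_zero (hψp l).ne_zero, (hφp p).factorization,
      (hψp l).factorization, Finsupp.add_apply, Finsupp.single_apply, Finsupp.single_apply]
  have hQne : ∀ {q}, q ∈ Q → ∀ p l, q ≠ φ p * ψ l := fun {q} hq p l h =>
    Nat.not_prime_mul (hφp p).ne_one (hψp l).ne_one (h ▸ hQ q hq)
  have hP : ∀ p, 3 ∣ ∑ l, s.count (φ p * ψ l) := by
    intro p
    rw [← sum_map_indicator]
    convert hdvd (φ p) using 2
    refine Multiset.map_congr rfl fun a ha => ?_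
    rcases hsA a ha with ha | ⟨q, m, -, rfl⟩
    · rw [(hQ a ha).factorization, Finsupp.single_apply, if_neg (fun h : a = φ p => hQφ p (h ▸ ha))]
      exact Finset.sum_eq_zero fun l _ => if_neg (hQne ha p l)
    · rw [hfac, if_neg (hne p m).symm, add_zero]
      by_cases h : q = p
      · subst h
        rw [if_pos rfl, Finset.sum_eq_single m]
        · simp
        · exact fun l _ hl => if_neg fun h => hl (hinj h).2.symm
        · simp
      · rw [if_neg fun h' => h (hφ h')]
        exact Finset.sum_eq_zero fun l _ => if_neg fun h' => h (hinj h').1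
  have hL : ∀ l, 3 ∣ ∑ p, s.count (φ p * ψ l) := by
    intro l
    rw [← sum_map_indicator (fun p => φ p * ψ l)]
    convert hdvd (ψ l) using 2
    refine Multiset.map_congr rfl fun a ha => ?_
    rcases hsA a ha with ha | ⟨q, m, -, rfl⟩
    · rw [(hQ a ha).factorization, Finsupp.single_apply, if_neg (fun h : a = ψ l => hQψ l (h ▸ ha))]
      exact Finset.sum_eq_zero fun p _ => if_neg (hQne ha p l)
    · rw [hfac, if_neg (hne q l), zero_add]
      by_cases h : m = l
      · subst h
        rw [if_pos rfl, Finset.sum_eq_single q]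
        · simp
        · exact fun p _ hp => if_neg fun h => hp (hinj h).1.symm
        · simp
      · rw [if_neg fun h' => h (hψ h')]
        exact Finset.sum_eq_zero fun p _ => if_neg fun h' => h (hinj h').2
  -- Distinct flags have distinct products, so the total weight is at most the 9 members of `s`.
  have htot : ∑ p, ∑ l, s.count (φ p * ψ l) < 12 := by
    have hg : Set.InjOn (fun e : P × L => φ e.1 * ψ e.2) (Finset.univ : Finset (P × L)) :=
      fun e _ f _ h => Prod.ext (hinj h).1 (hinj h).2
    rw [← Fintype.sum_prod_type (fun e : P × L => s.count (φ e.1 * ψ e.2)),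
      ← Finset.sum_image (f := fun a => s.count a) hg]
    refine lt_of_le_of_lt (b := 9) ?_ (by norm_num)
    rw [← hs, ← Multiset.sum_count_eq_card (s := Finset.image (fun e : P × L => φ e.1 * ψ e.2)
      Finset.univ ∪ s.toFinset) (fun a ha => by simp [ha])]
    exact Finset.sum_le_sum_of_subset Finset.subset_union_left
  have hflag : ∀ p l, s.count (φ p * ψ l) ≠ 0 → I p l := by
    intro p l h
    rcases hsA _ (Multiset.count_ne_zero.1 h) with h' | ⟨q, m, hI, h'⟩
    · exact absurd rfl (hQne h' p l)
    · obtain ⟨rfl, rfl⟩ := hinj h'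
      exact hI
  have hw := three_dvd_weight I hlin htri _ hflag hP hL htot
  rw [isTrivialSolution_iff]
  intro a
  by_cases has : a ∈ s
  · rcases hsA a has with ha | ⟨p, l, -, rfl⟩
    · have hc := sum_map_indicator (fun _ : Unit => a) s
      simp only [Finset.univ_unique, Finset.sum_singleton] at hc
      rw [← hc]
      convert hdvd a using 2
      refine Multiset.map_congr rfl fun b hb => ?_
      rcases hsA b hb with hb | ⟨p, l, -, rfl⟩
      · rw [(hQ b hb).factorization, Finsupp.single_apply]
      · rw [hfac, if_neg (hQne ha p l).symm, if_neg fun h : φ p = a => hQφ p (h ▸ ha),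
          if_neg fun h : ψ l = a => hQψ l (h ▸ ha)]
    · exact hw p l
  · rw [Multiset.count_eq_zero_of_notMem has]
    exact dvd_zero 3

theorem card_le_fMax {k d n : ℕ} {A : Finset ℕ} (hA : A ⊆ Finset.Icc 1 n)
    (hγ : (A : Set ℕ) ∈ gammaFamily k d) : A.card ≤ fMax k d n := by
  classical
  unfold fMax
  exact Finset.le_sup (f := Finset.card) (by simp [hA, hγ])

/-! ### The conic incidence structure -/

/-- Incidence between the points of affine 3-space and the lines `y = a x - b`, `z = a² x - c`,
whose directions `(1, a, a²)` form a conic. -/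
def ConicIncidence (F : Type*) [Field F] (p l : F × F × F) : Prop :=
  p.2.1 = l.1 * p.1 - l.2.1 ∧ p.2.2 = l.1 ^ 2 * p.1 - l.2.2

namespace ConicIncidence

variable {F : Type*} [Field F]

theorem line_ext {p l m : F × F × F} (hl : ConicIncidence F p l) (hm : ConicIncidence F p m)
    (h : l.1 = m.1) : l = m := by
  obtain ⟨h1, h2⟩ := hl
  obtain ⟨h3, h4⟩ := hm
  rw [h] at h1 h2
  refine Prod.ext h (Prod.ext ?_ ?_)
  · linear_combination h1 - h3
  · linear_combination h2 - h4

theorem point_ext {p q l : F × F × F} (hp : ConicIncidence F p l) (hq : ConicIncidence F q l)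
    (h : p.1 = q.1) : p = q := by
  obtain ⟨h1, h2⟩ := hp
  obtain ⟨h3, h4⟩ := hq
  rw [h] at h1 h2
  exact Prod.ext h (Prod.ext (h1.trans h3.symm) (h2.trans h4.symm))

theorem linear (p q l m : F × F × F) (hpl : ConicIncidence F p l) (hql : ConicIncidence F q l)
    (hpm : ConicIncidence F p m) (hqm : ConicIncidence F q m) : p = q ∨ l = m := by
  have h : (p.1 - q.1) * (l.1 - m.1) = 0 := by
    linear_combination hpm.1 - hqm.1 - hpl.1 + hql.1
  rcases mul_eq_zero.1 h with h | h
  · exact Or.inl (point_ext hpl hql (sub_eq_zero.1 h))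
  · exact Or.inr (line_ext hpl hpm (sub_eq_zero.1 h))

/-- Three distinct points of the conic are linearly independent (Vandermonde), so the sides of a
triangle cannot sum to zero. Applying `(t - k.1) * (t - l.1)` to the closing relation isolates the
side on `m`. -/
theorem triangle_free (p q r l m k : F × F × F) (hpl : ConicIncidence F p l)
    (hql : ConicIncidence F q l) (hqm : ConicIncidence F q m) (hrm : ConicIncidence F r m)
    (hrk : ConicIncidence F r k) (hpk : ConicIncidence F p k) :
    p = q ∨ q = r ∨ r = p ∨ l = m ∨ m = k ∨ k = l := by
  have h : (q.1 - r.1) * ((m.1 - k.1) * (m.1 - l.1)) = 0 := by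
    linear_combination -(hpl.2 - hql.2 + hqm.2 - hrm.2 + hrk.2 - hpk.2) +
      (k.1 + l.1) * (hpl.1 - hql.1 + hqm.1 - hrm.1 + hrk.1 - hpk.1)
  rcases mul_eq_zero.1 h with h | h
  · exact Or.inr (Or.inl (point_ext hqm hrm (sub_eq_zero.1 h)))
  rcases mul_eq_zero.1 h with h | h
  · exact Or.inr (Or.inr (Or.inr (Or.inr (Or.inl (line_ext hrm hrk (sub_eq_zero.1 h))))))
  · exact Or.inr (Or.inr (Or.inr (Or.inl (line_ext hqm hql (sub_eq_zero.1 h)).symm)))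

/-- The line through `p` in the direction `(1, a, a²)`. -/
def lineThrough (p : F × F × F) (a : F) : F × F × F :=
  (a, a * p.1 - p.2.1, a ^ 2 * p.1 - p.2.2)

theorem iff_lineThrough {p l : F × F × F} : ConicIncidence F p l ↔ l = lineThrough p l.1 := by
  constructor
  · rintro ⟨h1, h2⟩
    refine Prod.ext rfl (Prod.ext ?_ ?_)
    · simp only [lineThrough]
      linear_combination h1
    · simp only [lineThrough]
      linear_combination h2
  · intro h
    rw [h]
    constructor <;> simp [lineThrough]

end ConicIncidence

/-! ### The lower bound -/

theorem primeCounting_add_pow_le_fMax {n r : ℕ} (hr : r.Prime)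
    (hrn : 2 * r ^ 3 ≤ Nat.primeCounting n.sqrt) :
    Nat.primeCounting n + r ^ 4 ≤ fMax 9 3 n + 2 * r ^ 3 := by
  classical
  have : Fact r.Prime := ⟨hr⟩
  let V := ZMod r × ZMod r × ZMod r
  have hV : Fintype.card (V ⊕ V) = 2 * r ^ 3 := by
    simp only [V, Fintype.card_sum, Fintype.card_prod, ZMod.card]
    ring
  obtain ⟨f⟩ : Nonempty (V ⊕ V ↪ Nat.primesLE n.sqrt) := by
    apply Function.Embedding.nonempty_of_card_le
    rw [hV, Fintype.card_coe, Nat.primesLE_card_eq_primeCounting]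
    exact hrn
  have hfp : ∀ v, (f v : ℕ).Prime := fun v => Nat.prime_of_mem_primesLE (f v).2
  have hfle : ∀ v, (f v : ℕ) ≤ n.sqrt := fun v => Nat.le_of_mem_primesLE (f v).2
  have hfinj : ∀ {v w}, (f v : ℕ) = f w → v = w := fun h => f.injective (Subtype.ext h)
  let φ : V → ℕ := fun p => f (Sum.inl p)
  let ψ : V → ℕ := fun l => f (Sum.inr l)
  let R : Finset ℕ := Finset.univ.image fun v => (f v : ℕ)
  let E : Finset ℕ := Finset.univ.image fun e : V × ZMod r =>
    φ e.1 * ψ (ConicIncidence.lineThrough e.1 e.2)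
  have hQ : ∀ q ∈ Nat.primesLE n \ R, q.Prime := fun q hq =>
    Nat.prime_of_mem_primesLE (Finset.mem_sdiff.1 hq).1
  have hRQ : ∀ v, (f v : ℕ) ∉ ((Nat.primesLE n \ R : Finset ℕ) : Set ℕ) := by
    intro v hv
    exact (Finset.mem_sdiff.1 hv).2 (Finset.mem_image_of_mem _ (Finset.mem_univ v))
  have hmem := mem_gammaFamily_of_incidence (ConicIncidence (ZMod r))
    ConicIncidence.linear ConicIncidence.triangle_free φ ψ
    (fun _ _ h => Sum.inl_injective (hfinj h)) (fun _ _ h => Sum.inr_injective (hfinj h))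
    (fun _ => hfp _) (fun _ => hfp _) (fun p l h => Sum.inl_ne_inr (hfinj h))
    (Nat.primesLE n \ R : Finset ℕ) hQ (fun _ => hRQ _) (fun _ => hRQ _)
  have hcoe : (((Nat.primesLE n \ R) ∪ E : Finset ℕ) : Set ℕ) =
      ((Nat.primesLE n \ R : Finset ℕ) : Set ℕ) ∪
        {a | ∃ p l, ConicIncidence (ZMod r) p l ∧ a = φ p * ψ l} := by
    rw [Finset.coe_union]
    congr 1
    ext a
    simp only [E, Finset.coe_image, Finset.coe_univ, Set.image_univ, Set.mem_range,
      Set.mem_ofPred_eq]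
    constructor
    · rintro ⟨⟨p, a⟩, rfl⟩
      exact ⟨p, _, ConicIncidence.iff_lineThrough.2 rfl, rfl⟩
    · rintro ⟨p, l, h, rfl⟩
      exact ⟨(p, l.1), by rw [← ConicIncidence.iff_lineThrough.1 h]⟩
  rw [← hcoe] at hmem
  have hsub : (Nat.primesLE n \ R) ∪ E ⊆ Finset.Icc 1 n := by
    intro a ha
    rw [Finset.mem_Icc]
    refine ⟨hmem.1 a ha, ?_⟩
    rcases Finset.mem_union.1 ha with ha | ha
    · exact Nat.le_of_mem_primesLE (Finset.mem_sdiff.1 ha).1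
    · obtain ⟨e, -, rfl⟩ := Finset.mem_image.1 ha
      exact (Nat.mul_le_mul (hfle _) (hfle _)).trans (Nat.sqrt_le n)
  have hE : E.card = r ^ 4 := by
    rw [Finset.card_image_of_injective]
    · simp only [V, Finset.card_univ, Fintype.card_prod, ZMod.card]
      ring
    · rintro ⟨p, a⟩ ⟨q, b⟩ h
      have h : φ p * ψ (ConicIncidence.lineThrough p a) =
        φ q * ψ (ConicIncidence.lineThrough q b) := h
      have hd : φ p ∣ φ q * ψ (ConicIncidence.lineThrough q b) := h ▸ dvd_mul_right _ _
      rcases (hfp _).dvd_mul.1 hd with h' | h'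
      · have hpq : p = q :=
          Sum.inl_injective (hfinj ((Nat.prime_dvd_prime_iff_eq (hfp _) (hfp _)).1 h'))
        subst hpq
        have := Sum.inr_injective (hfinj (Nat.eq_of_mul_eq_mul_left (hfp _).pos h))
        exact Prod.ext rfl (congrArg Prod.fst this)
      · exact absurd (hfinj ((Nat.prime_dvd_prime_iff_eq (hfp _) (hfp _)).1 h')) Sum.inl_ne_inr
  have hdisj : Disjoint (Nat.primesLE n \ R) E := by
    rw [Finset.disjoint_left]
    intro a ha hE
    obtain ⟨e, -, rfl⟩ := Finset.mem_image.1 hE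
    exact Nat.not_prime_mul (hfp _).ne_one (hfp _).ne_one (hQ _ ha)
  have hcard := card_le_fMax hsub hmem
  rw [Finset.card_union_of_disjoint hdisj, hE] at hcard
  have h1 := Finset.le_card_sdiff R (Nat.primesLE n)
  have h2 : R.card ≤ 2 * r ^ 3 := hV ▸ Finset.card_image_le
  rw [Nat.primesLE_card_eq_primeCounting] at h1
  omega

/-- Adjoining 1 to the primes is harmless: every prime has multiplicity divisible by 3, hence so has
1, because `3 ∣ 9`. This covers the small `n`, where the construction gains nothing. -/
theorem primeCounting_succ_le_fMax {n : ℕ} (hn : 1 ≤ n) :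
    Nat.primeCounting n + 1 ≤ fMax 9 3 n := by
  classical
  rw [← Nat.primesLE_card_eq_primeCounting,
    ← Finset.card_insert_of_notMem (a := 1) (s := Nat.primesLE n)
      fun h => Nat.not_prime_one (Nat.prime_of_mem_primesLE h)]
  have hprime : ∀ a ∈ insert 1 (Nat.primesLE n), a = 1 ∨ a.Prime := fun a ha =>
    (Finset.mem_insert.1 ha).imp_right Nat.prime_of_mem_primesLE
  have hpos : ∀ a ∈ insert 1 (Nat.primesLE n), 0 < a := fun a ha =>
    (hprime a ha).elim (fun h => h ▸ one_pos) Nat.Prime.pos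
  refine card_le_fMax (fun a ha => Finset.mem_Icc.2 ⟨hpos a ha, ?_⟩)
    ⟨hpos, fun s hs hsA ⟨x, hx⟩ => ?_⟩
  · rcases Finset.mem_insert.1 ha with rfl | ha
    exacts [hn, Nat.le_of_mem_primesLE ha]
  have hcube : s.prod = x.natAbs ^ 3 := by
    have := congrArg Int.natAbs hx
    rwa [Int.natAbs_natCast, Int.natAbs_pow] at this
  have hcount : ∀ a, a ≠ 1 → 3 ∣ s.count a := by
    intro a ha1
    by_cases has : a ∈ s
    · have hap := (hprime a (hsA a has)).resolve_left ha1
      have hd : 3 ∣ (s.map fun b => b.factorization a).sum := by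
        rw [← factorization_multiset_prod (fun a ha => (hpos a (hsA a ha)).ne'), hcube,
          Nat.factorization_pow]
        simp
      have hc := sum_map_indicator (fun _ : Unit => a) s
      simp only [Finset.univ_unique, Finset.sum_singleton] at hc
      rw [← hc]
      convert hd using 2
      refine Multiset.map_congr rfl fun b hb => ?_
      rcases hprime b (hsA b hb) with rfl | hb
      · simp [ha1.symm]
      · rw [hb.factorization, Finsupp.single_apply]
    · rw [Multiset.count_eq_zero_of_notMem has]
      exact dvd_zero 3
  rw [isTrivialSolution_iff]
  intro a
  by_cases ha1 : a = 1
  · subst ha1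
    have hsum := Multiset.sum_count_eq_card (s := insert 1 s.toFinset) (m := s)
      (fun a ha => by simp [ha])
    rw [← Finset.sum_erase_add _ _ (Finset.mem_insert_self 1 s.toFinset), hs] at hsum
    have hd : 3 ∣ ∑ a ∈ (insert 1 s.toFinset).erase 1, s.count a :=
      Finset.dvd_sum fun a ha => hcount a (Finset.ne_of_mem_erase ha)
    omega
  · exact hcount a ha1

/-- Take the largest admissible prime and apply Bertrand's postulate; `54 = 2 * 3 ^ 3` makes 3
admissible. -/
theorem exists_prime_cube_le {m : ℕ} (hm : 54 ≤ m) :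
    ∃ r, r.Prime ∧ 3 ≤ r ∧ 2 * r ^ 3 ≤ m ∧ m < 16 * r ^ 3 := by
  have hex : ∃ r, (r.Prime ∧ 2 * r ^ 3 ≤ m) ∧ ∀ q, q.Prime ∧ 2 * q ^ 3 ≤ m → q ≤ r := by
    classical
    have hb : ∀ q, q.Prime ∧ 2 * q ^ 3 ≤ m → q ≤ m := fun q hq => by
      have := Nat.le_self_pow (three_ne_zero) q
      omega
    have h3 : Nat.Prime 3 ∧ 2 * 3 ^ 3 ≤ m := ⟨Nat.prime_three, by omega⟩
    exact ⟨Nat.findGreatest (fun q => q.Prime ∧ 2 * q ^ 3 ≤ m) m,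
      Nat.findGreatest_spec (P := fun q => q.Prime ∧ 2 * q ^ 3 ≤ m) (hb 3 h3) h3,
      fun q hq => Nat.le_findGreatest (hb q hq) hq⟩
  obtain ⟨r, ⟨hr, hrm⟩, hmax⟩ := hex
  refine ⟨r, hr, hmax 3 ⟨Nat.prime_three, by omega⟩, hrm, ?_⟩
  obtain ⟨q, hq, hrq, hq2⟩ := Nat.exists_prime_lt_and_le_two_mul r hr.ne_zero
  by_contra! h
  refine absurd (hmax q ⟨hq, ?_⟩) (by omega)
  have := Nat.pow_le_pow_left hq2 3
  rw [mul_pow] at this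
  omega

/-- Chebyshev's lower bound for `π`, obtained through `ψ` at `⌊√n⌋`. -/
theorem sqrt_div_log_le {n : ℕ} (hn : 2 ≤ n) :
    √(n : ℝ) / Real.log n ≤ 4 * (Nat.primeCounting n.sqrt + 1) := by
  have hlog : 0 < Real.log n := Real.log_pos (by exact_mod_cast hn)
  rw [div_le_iff₀ hlog]
  set s := n.sqrt with hs
  have hs1 : 1 ≤ s := by rw [hs, Nat.le_sqrt]; omega
  have hsn : s + 1 ≤ n := by
    have := Nat.sqrt_lt_self (n := n) (by omega)
    omega
  have h1 : √(n : ℝ) ≤ s + 1 := Real.real_sqrt_le_nat_sqrt_succ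
  have h2 := (Chebyshev.psi_ge s).trans (Chebyshev.psi_le_primeCounting_mul_log s)
  have h3 : Real.log (s + 1) ≤ Real.log n := Real.log_le_log (by positivity) (by exact_mod_cast hsn)
  have h4 : Real.log s ≤ Real.log n :=
    Real.log_le_log (by exact_mod_cast hs1) (by exact_mod_cast (by omega : s ≤ n))
  have h5 : (Nat.primeCounting s : ℝ) * Real.log s ≤ Nat.primeCounting s * Real.log n := by gcongr
  have h6 := Real.log_two_gt_d9
  have h7 : (1 : ℝ) ≤ s := by exact_mod_cast hs1
  nlinarith

theorem lower_bound :
    ∃ c : ℝ, 0 < c ∧ ∀ n : ℕ, 2 ≤ n →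
      c * ((n : ℝ) ^ (2 / 3 : ℝ) / Real.log n ^ (4 / 3 : ℝ))
        ≤ (fMax 9 3 n : ℝ) - (Nat.primeCounting n : ℝ) := by
  refine ⟨1 / (3 * 256 ^ (4 / 3 : ℝ)), by positivity, fun n hn => ?_⟩
  have hlog : 0 < Real.log n := Real.log_pos (by exact_mod_cast hn)
  set m := Nat.primeCounting n.sqrt with hm
  have hX : (n : ℝ) ^ (2 / 3 : ℝ) / Real.log n ^ (4 / 3 : ℝ) =
      (√(n : ℝ) / Real.log n) ^ (4 / 3 : ℝ) := by
    rw [Real.div_rpow (Real.sqrt_nonneg _) hlog.le, Real.sqrt_eq_rpow,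
      ← Real.rpow_mul (Nat.cast_nonneg n)]
    norm_num
  rw [hX, one_div_mul_eq_div, div_le_iff₀ (by positivity)]
  have hle := sqrt_div_log_le hn
  rw [← hm] at hle
  rcases lt_or_ge m 54 with hsmall | hbig
  · have h1 : (Nat.primeCounting n : ℝ) + 1 ≤ fMax 9 3 n := by
      exact_mod_cast primeCounting_succ_le_fMax (by omega : 1 ≤ n)
    have h2 : (√(n : ℝ) / Real.log n) ^ (4 / 3 : ℝ) ≤ 256 ^ (4 / 3 : ℝ) := by
      apply Real.rpow_le_rpow (by positivity) _ (by norm_num)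
      have : (m : ℝ) + 1 ≤ 54 := by exact_mod_cast hsmall
      linarith
    have h3 : (0 : ℝ) < 256 ^ (4 / 3 : ℝ) := by positivity
    nlinarith
  · obtain ⟨r, hr, hr3, hrm, hmr⟩ := exists_prime_cube_le hbig
    have h1 : (Nat.primeCounting n : ℝ) + (r : ℝ) ^ 4 ≤ fMax 9 3 n + 2 * (r : ℝ) ^ 3 := by
      exact_mod_cast primeCounting_add_pow_le_fMax hr (hm ▸ hrm)
    have hr3' : (3 : ℝ) ≤ r := by exact_mod_cast hr3
    -- `r ≥ 3` makes the loss `2 r³` at most two thirds of the gain `r⁴`.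
    have h2 : (r : ℝ) ^ 4 / 3 ≤ fMax 9 3 n - (Nat.primeCounting n : ℝ) := by
      have : 0 ≤ (r : ℝ) ^ 3 * (r - 3) := mul_nonneg (by positivity) (by linarith)
      nlinarith
    have h3 : (√(n : ℝ) / Real.log n) ^ (4 / 3 : ℝ) ≤ 256 ^ (4 / 3 : ℝ) * (r : ℝ) ^ 4 := by
      have h4 : √(n : ℝ) / Real.log n ≤ 256 * (r : ℝ) ^ 3 := by
        have h5 : (m : ℝ) + 1 ≤ 16 * (r : ℝ) ^ 3 := by exact_mod_cast hmr
        have h6 : (0 : ℝ) ≤ (r : ℝ) ^ 3 := by positivity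
        linarith
      refine (Real.rpow_le_rpow (by positivity) h4 (by norm_num)).trans_eq ?_
      rw [Real.mul_rpow (by norm_num) (by positivity), ← Real.rpow_natCast (r : ℝ) 3,
        ← Real.rpow_mul (by positivity), ← Real.rpow_natCast (r : ℝ) 4]
      norm_num
    have h7 : (0 : ℝ) < 256 ^ (4 / 3 : ℝ) := by positivity
    nlinarith

/-! ### Bipartite graphs without short cycles -/

section Bipartite

variable {α β : Type*} [DecidableEq α] [DecidableEq β]

/-- A bipartite graph without quadrilaterals: its size exceeds the number of left vertices by at
most the square of the number of right vertices. -/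
theorem card_le_of_quadrilateral_free {X : Finset α} {Y : Finset β} {E : Finset (α × β)}
    (hE : E ⊆ X ×ˢ Y)
    (h4 : ∀ x x' y y', (x, y) ∈ E → (x', y) ∈ E → (x, y') ∈ E → (x', y') ∈ E → x = x' ∨ y = y') :
    E.card ≤ X.card + Y.card ^ 2 := by
  let S : α → Finset β := fun x => Y.filter fun y => (x, y) ∈ E
  have hEsum : E.card = ∑ x ∈ X, (S x).card := by
    rw [Finset.card_eq_sum_card_fiberwise (f := Prod.fst) (t := X)
      fun e he => (Finset.mem_product.1 (hE he)).1]
    refine Finset.sum_congr rfl fun x _ => ?_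
    refine Finset.card_bij' (fun e _ => e.2) (fun y _ => (x, y)) ?_ ?_ ?_ ?_
    · rintro ⟨a, b⟩ h
      obtain ⟨hab, rfl⟩ := Finset.mem_filter.1 h
      exact Finset.mem_filter.2 ⟨(Finset.mem_product.1 (hE hab)).2, hab⟩
    · intro y h
      exact Finset.mem_filter.2 ⟨(Finset.mem_filter.1 h).2, rfl⟩
    · rintro ⟨a, b⟩ h
      obtain ⟨h, rfl⟩ := Finset.mem_filter.1 h
      rfl
    · intro y h
      rfl
  have hdisj : (X : Set α).PairwiseDisjoint fun x => (S x).offDiag := by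
    intro x _ x' _ hxx'
    refine Finset.disjoint_left.2 ?_
    rintro ⟨y, y'⟩ h h'
    simp only [S, Finset.mem_offDiag, Finset.mem_filter] at h h'
    rcases h4 x x' y y' h.1.2 h'.1.2 h.2.1.2 h'.2.1.2 with h0 | h0
    exacts [hxx' h0, h.2.2 h0]
  have hpairs : ∑ x ∈ X, (S x).offDiag.card ≤ Y.card ^ 2 := by
    rw [← Finset.card_biUnion hdisj, sq, ← Finset.card_product]
    refine Finset.card_le_card fun e he => ?_
    obtain ⟨x, -, h⟩ := Finset.mem_biUnion.1 he
    simp only [S, Finset.mem_offDiag, Finset.mem_filter] at h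
    exact Finset.mem_product.2 ⟨h.1.1, h.2.1.1⟩
  calc E.card = ∑ x ∈ X, (S x).card := hEsum
    -- `d ≤ 1 + d (d - 1)` for every natural number `d`; a pair of right vertices has at most one
    -- common neighbour.
    _ ≤ ∑ x ∈ X, (1 + (S x).offDiag.card) := by
      refine Finset.sum_le_sum fun x _ => ?_
      rw [Finset.offDiag_card]
      rcases Nat.lt_or_ge (S x).card 2 with h | h
      · omega
      · have := Nat.mul_le_mul_right (S x).card h
        omega
    _ = X.card + ∑ x ∈ X, (S x).offDiag.card := by
      rw [Finset.sum_add_distrib, Finset.card_eq_sum_ones]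
    _ ≤ _ := by omega

/-- The edges at vertices of degree less than a quarter of the average degree are at most a quarter
of all edges. -/
theorem four_mul_card_lowDegree_le {γ δ : Type*} [DecidableEq δ] (E : Finset γ) (f : γ → δ)
    {X : Finset δ} (hf : ∀ e ∈ E, f e ∈ X) :
    4 * (E.filter fun e => 4 * X.card * (E.filter fun e' => f e' = f e).card < E.card).card
      ≤ E.card := by
  set B := E.filter fun e => 4 * X.card * (E.filter fun e' => f e' = f e).card < E.card with hB
  rcases X.eq_empty_or_nonempty with rfl | hX
  · have hE : E = ∅ := Finset.eq_empty_of_forall_notMem fun e he => by simpa using hf e he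
    have : B = ∅ := by rw [hB, hE, Finset.filter_empty]
    simp [this]
  refine Nat.le_of_mul_le_mul_left ?_ hX.card_pos
  calc X.card * (4 * B.card) = ∑ x ∈ X, 4 * X.card * (B.filter fun e => f e = x).card := by
        rw [← Finset.mul_sum, ← Finset.card_eq_sum_card_fiberwise (f := f) (t := X)
          fun e he => hf e (Finset.mem_filter.1 he).1]
        ring
    _ ≤ ∑ _x ∈ X, E.card := by
        refine Finset.sum_le_sum fun x _ => ?_
        rcases (B.filter fun e => f e = x).eq_empty_or_nonempty with h | ⟨e, he⟩
        · rw [h]; simp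
        · obtain ⟨heB, rfl⟩ := Finset.mem_filter.1 he
          have hlow := (Finset.mem_filter.1 heB).2
          refine le_trans (Nat.mul_le_mul_left _ (Finset.card_le_card ?_)) hlow.le
          exact Finset.filter_subset_filter _ (Finset.filter_subset _ _)
    _ = X.card * E.card := by rw [Finset.sum_const, smul_eq_mul]

/-- In a bipartite graph without quadrilaterals and hexagons, the number of paths with three edges
is at most the number of pairs of a left and a right vertex. -/
theorem sum_paths_le {X : Finset α} {Y : Finset β} {E : Finset (α × β)} (hE : E ⊆ X ×ˢ Y)
    (h4 : ∀ x x' y y', (x, y) ∈ E → (x', y) ∈ E → (x, y') ∈ E → (x', y') ∈ E → x = x' ∨ y = y')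
    (h6 : ∀ x₁ x₂ x₃ y₁ y₂ y₃, (x₁, y₁) ∈ E → (x₂, y₁) ∈ E → (x₂, y₂) ∈ E → (x₃, y₂) ∈ E →
      (x₃, y₃) ∈ E → (x₁, y₃) ∈ E →
      x₁ = x₂ ∨ x₂ = x₃ ∨ x₃ = x₁ ∨ y₁ = y₂ ∨ y₂ = y₃ ∨ y₃ = y₁) :
    ∑ e ∈ E, ((E.filter fun e' => e'.2 = e.2).card - 1) * ((E.filter fun e' => e'.1 = e.1).card - 1)
      ≤ X.card * Y.card := by
  -- The pairs of ends of the three-edge paths with middle edge `e`. A pair shared by two middle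
  -- edges would close a 4-cycle or a 6-cycle.
  let S : α × β → Finset (α × β) := fun e =>
    (((E.filter fun e' => e'.2 = e.2).erase e).image Prod.fst) ×ˢ
      (((E.filter fun e' => e'.1 = e.1).erase e).image Prod.snd)
  have hS : ∀ {e f}, f ∈ S e →
      (f.1 ≠ e.1 ∧ (f.1, e.2) ∈ E) ∧ (f.2 ≠ e.2 ∧ (e.1, f.2) ∈ E) := by
    rintro ⟨x, y⟩ ⟨x', y'⟩ h
    simpa [S] using h
  have hcard : ∀ e ∈ E, ((E.filter fun e' => e'.2 = e.2).card - 1) *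
      ((E.filter fun e' => e'.1 = e.1).card - 1) = (S e).card := by
    intro e he
    rw [Finset.card_product, Finset.card_image_of_injOn, Finset.card_image_of_injOn,
      Finset.card_erase_of_mem (by simp [he]), Finset.card_erase_of_mem (by simp [he])]
    · rintro ⟨x, y⟩ h ⟨x', y'⟩ h' hh
      simp only [Finset.coe_erase, Finset.coe_filter, Set.mem_sdiff, Set.mem_ofPred_eq] at h h' hh
      exact Prod.ext (h.1.2.trans h'.1.2.symm) hh
    · rintro ⟨x, y⟩ h ⟨x', y'⟩ h' hh
      simp only [Finset.coe_erase, Finset.coe_filter, Set.mem_sdiff, Set.mem_ofPred_eq] at h h' hh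
      exact Prod.ext hh (h.1.2.trans h'.1.2.symm)
  rw [Finset.sum_congr rfl hcard, ← Finset.card_biUnion, ← Finset.card_product]
  · refine Finset.card_le_card fun f hf => ?_
    obtain ⟨e, he, hf⟩ := Finset.mem_biUnion.1 hf
    have h := hS hf
    exact Finset.mem_product.2
      ⟨(Finset.mem_product.1 (hE h.1.2)).1, (Finset.mem_product.1 (hE h.2.2)).2⟩
  · rintro ⟨x, y⟩ he ⟨w, z⟩ he' hne
    refine Finset.disjoint_left.2 ?_
    rintro ⟨x', y'⟩ h h'
    obtain ⟨⟨hx, hx'y⟩, hy, hxy'⟩ := hS h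
    obtain ⟨⟨hw, hx'z⟩, hz, hwy'⟩ := hS h'
    dsimp only at hx hx'y hy hxy' hw hx'z hz hwy'
    by_cases hxw : x = w
    · subst hxw
      rcases h4 _ _ _ _ hx'y he hx'z he' with h0 | h0
      exacts [hx h0, hne (by rw [h0])]
    by_cases hyz : y = z
    · subst hyz
      rcases h4 _ _ _ _ he he' hxy' hwy' with h0 | h0
      exacts [hxw h0, hy h0.symm]
    rcases h6 _ _ _ _ _ _ hx'y he hxy' hwy' he' hx'z with h0 | h0 | h0 | h0 | h0 | h0
    exacts [hx h0, hxw h0, hw h0.symm, hy h0.symm, hz h0, hyz h0.symm]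

/-- A bipartite graph without quadrilaterals and hexagons whose average degrees are at least `8`
has `O((|X| |Y|) ^ (2 / 3))` edges. -/
theorem card_pow_three_le {X : Finset α} {Y : Finset β} {E : Finset (α × β)} (hE : E ⊆ X ×ˢ Y)
    (h4 : ∀ x x' y y', (x, y) ∈ E → (x', y) ∈ E → (x, y') ∈ E → (x', y') ∈ E → x = x' ∨ y = y')
    (h6 : ∀ x₁ x₂ x₃ y₁ y₂ y₃, (x₁, y₁) ∈ E → (x₂, y₁) ∈ E → (x₂, y₂) ∈ E → (x₃, y₂) ∈ E →
      (x₃, y₃) ∈ E → (x₁, y₃) ∈ E →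
      x₁ = x₂ ∨ x₂ = x₃ ∨ x₃ = x₁ ∨ y₁ = y₂ ∨ y₂ = y₃ ∨ y₃ = y₁)
    (hX : 8 * X.card ≤ E.card) (hY : 8 * Y.card ≤ E.card) :
    E.card ^ 3 ≤ 128 * (X.card * Y.card) ^ 2 := by
  let dX : α × β → ℕ := fun e => (E.filter fun e' => e'.1 = e.1).card
  let dY : α × β → ℕ := fun e => (E.filter fun e' => e'.2 = e.2).card
  have hbX := four_mul_card_lowDegree_le E Prod.fst (X := X)
    fun e he => (Finset.mem_product.1 (hE he)).1
  have hbY := four_mul_card_lowDegree_le E Prod.snd (X := Y)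
    fun e he => (Finset.mem_product.1 (hE he)).2
  set BX := E.filter fun e => 4 * X.card * (E.filter fun e' => e'.1 = e.1).card < E.card with hBX
  set BY := E.filter fun e => 4 * Y.card * (E.filter fun e' => e'.2 = e.2).card < E.card with hBY
  set G := E \ (BX ∪ BY) with hG
  have hGcard : E.card ≤ 2 * G.card := by
    have h1 := Finset.le_card_sdiff (BX ∪ BY) E
    have h2 := Finset.card_union_le BX BY
    rw [← hG] at h1
    omega
  have hpaths := sum_paths_le hE h4 h6
  -- A quarter of an average degree of at least 8 is at least 2, so `d - 1 ≥ d / 2`.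
  have hdeg : ∀ {M d : ℕ}, 8 * M ≤ E.card → E.card ≤ 4 * M * d → 0 < M →
      E.card ≤ 8 * M * (d - 1) := by
    intro M d h1 h2 hM
    have hd : 2 ≤ d := by
      by_contra! h
      have : d ≤ 1 := by omega
      have := Nat.mul_le_mul_left (4 * M) this
      omega
    obtain ⟨k, rfl⟩ := Nat.exists_eq_add_of_le hd
    rw [show 2 + k - 1 = 1 + k by omega]
    nlinarith [Nat.zero_le (M * k)]
  have hgood : ∀ e ∈ G, E.card ^ 2 ≤ 64 * (X.card * Y.card) * ((dY e - 1) * (dX e - 1)) := by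
    intro e he
    obtain ⟨heE, heB⟩ := Finset.mem_sdiff.1 he
    have hmem := Finset.mem_product.1 (hE heE)
    rw [Finset.mem_union, not_or, hBX, hBY, Finset.mem_filter, Finset.mem_filter] at heB
    have h1 := hdeg hX (not_lt.1 fun h => heB.1 ⟨heE, h⟩) (Finset.card_pos.2 ⟨_, hmem.1⟩)
    have h2 := hdeg hY (not_lt.1 fun h => heB.2 ⟨heE, h⟩) (Finset.card_pos.2 ⟨_, hmem.2⟩)
    calc E.card ^ 2 = E.card * E.card := sq _
      _ ≤ _ := Nat.mul_le_mul h1 h2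
      _ = _ := by simp only [dX, dY]; ring
  calc E.card ^ 3 = E.card * E.card ^ 2 := by ring
    _ ≤ 2 * G.card * E.card ^ 2 := Nat.mul_le_mul_right _ hGcard
    _ = 2 * ∑ _e ∈ G, E.card ^ 2 := by rw [Finset.sum_const, smul_eq_mul, mul_assoc]
    _ ≤ 2 * ∑ e ∈ G, 64 * (X.card * Y.card) * ((dY e - 1) * (dX e - 1)) :=
      Nat.mul_le_mul_left _ (Finset.sum_le_sum hgood)
    _ = 128 * (X.card * Y.card) * ∑ e ∈ G, (dY e - 1) * (dX e - 1) := by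
      rw [← Finset.mul_sum]; ring
    _ ≤ 128 * (X.card * Y.card) * ∑ e ∈ E, (dY e - 1) * (dX e - 1) :=
      Nat.mul_le_mul_left _ (Finset.sum_le_sum_of_subset Finset.sdiff_subset)
    _ ≤ 128 * (X.card * Y.card) * (X.card * Y.card) := Nat.mul_le_mul_left _ hpaths
    _ = _ := by ring

end Bipartite

/-! ### Short cycles give nontrivial solutions -/

section Cycles

variable {A : Set ℕ} {E : Finset (ℕ × ℕ)}

/-- Weights 4, 2, 2, 1 on a 4-cycle have total 9 and sums 6, 3 at the vertices of each side. -/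
theorem quadrilateral_free_of_mem_gammaFamily (hA : A ∈ gammaFamily 9 3)
    (hE : ∀ e ∈ E, e.1 * e.2 ∈ A) (x x' y y' : ℕ) (h₁ : (x, y) ∈ E) (h₂ : (x', y) ∈ E)
    (h₃ : (x, y') ∈ E) (h₄ : (x', y') ∈ E) : x = x' ∨ y = y' := by
  by_contra! hne
  obtain ⟨hx, hy⟩ := hne
  have hx0 := Nat.pos_of_mul_pos_right (hA.1 _ (hE _ h₁))
  have hy0 := Nat.pos_of_mul_pos_left (hA.1 _ (hE _ h₁))
  have htriv := hA.2 (Multiset.replicate 4 (x * y) + Multiset.replicate 2 (x' * y) +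
    Multiset.replicate 2 (x * y') + Multiset.replicate 1 (x' * y')) (by simp) (by
      intro a ha
      simp only [Multiset.mem_add, Multiset.mem_replicate] at ha
      rcases ha with ((⟨-, rfl⟩ | ⟨-, rfl⟩) | ⟨-, rfl⟩) | ⟨-, rfl⟩
      exacts [hE _ h₁, hE _ h₂, hE _ h₃, hE _ h₄])
    ⟨(x * y * x * x' * y * y' : ℕ), by
      simp only [Multiset.prod_add, Multiset.prod_replicate]
      push_cast
      ring⟩
  rw [isTrivialSolution_iff] at htriv
  have h := htriv (x * y)
  have h1 : x' * y ≠ x * y := fun h => hx (Nat.eq_of_mul_eq_mul_right hy0 h).symm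
  have h2 : x * y' ≠ x * y := fun h => hy (Nat.eq_of_mul_eq_mul_left hx0 h).symm
  simp only [Multiset.count_add, Multiset.count_replicate, if_neg h1, if_neg h2, if_true] at h
  -- The products `x' * y'` and `x * y` may coincide, but the multiplicity is then 5 instead of 4.
  split_ifs at h <;> omega

/-- Alternating weights 1, 2 around a 6-cycle have total 9 and sum 3 at each vertex. Injectivity
keeps the multiplicity of `x₁ * y₁` equal to 1. -/
theorem hexagon_free_of_mem_gammaFamily (hA : A ∈ gammaFamily 9 3)
    (hE : ∀ e ∈ E, e.1 * e.2 ∈ A) (hinj : Set.InjOn (fun e : ℕ × ℕ => e.1 * e.2) E)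
    (x₁ x₂ x₃ y₁ y₂ y₃ : ℕ) (h₁ : (x₁, y₁) ∈ E) (h₂ : (x₂, y₁) ∈ E) (h₃ : (x₂, y₂) ∈ E)
    (h₄ : (x₃, y₂) ∈ E) (h₅ : (x₃, y₃) ∈ E) (h₆ : (x₁, y₃) ∈ E) :
    x₁ = x₂ ∨ x₂ = x₃ ∨ x₃ = x₁ ∨ y₁ = y₂ ∨ y₂ = y₃ ∨ y₃ = y₁ := by
  by_contra! hne
  obtain ⟨hx12, hx23, hx31, hy12, hy23, hy31⟩ := hne
  have htriv := hA.2 (Multiset.replicate 1 (x₁ * y₁) + Multiset.replicate 2 (x₂ * y₁) +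
    Multiset.replicate 1 (x₂ * y₂) + Multiset.replicate 2 (x₃ * y₂) +
    Multiset.replicate 1 (x₃ * y₃) + Multiset.replicate 2 (x₁ * y₃)) (by simp) (by
      intro a ha
      simp only [Multiset.mem_add, Multiset.mem_replicate] at ha
      rcases ha with ((((⟨-, rfl⟩ | ⟨-, rfl⟩) | ⟨-, rfl⟩) | ⟨-, rfl⟩) | ⟨-, rfl⟩) | ⟨-, rfl⟩
      exacts [hE _ h₁, hE _ h₂, hE _ h₃, hE _ h₄, hE _ h₅, hE _ h₆])
    ⟨(x₁ * x₂ * x₃ * y₁ * y₂ * y₃ : ℕ), by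
      simp only [Multiset.prod_add, Multiset.prod_replicate]
      push_cast
      ring⟩
  rw [isTrivialSolution_iff] at htriv
  have h := htriv (x₁ * y₁)
  have hne : ∀ {x y}, (x, y) ∈ E → x ≠ x₁ ∨ y ≠ y₁ → x * y ≠ x₁ * y₁ := by
    intro x y hxy h0 h
    have := hinj hxy h₁ h
    rw [Prod.mk.injEq] at this
    exact h0.elim (fun h => h this.1) (fun h => h this.2)
  simp only [Multiset.count_add, Multiset.count_replicate, if_true,
    if_neg (hne h₂ (Or.inl hx12.symm)), if_neg (hne h₃ (Or.inl hx12.symm)),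
    if_neg (hne h₄ (Or.inl hx31)), if_neg (hne h₅ (Or.inl hx31)),
    if_neg (hne h₆ (Or.inr hy31))] at h
  omega

end Cycles

/-! ### The upper bound -/

/-- Let `u` be the largest divisor up to `K`. If the cofactor `v` exceeds `K`, a prime `p ∣ v` has
`p ≤ u` and `u * p > K`, so `u² ≥ K + 1` and `a² = u² v² ≥ (K + 1)³ > n²`. -/
theorem exists_factorization_le {K n a : ℕ} (hK : 1 ≤ K) (hn : n ^ 2 < (K + 1) ^ 3) (ha0 : 0 < a)
    (ha : a ≤ n) (hp : ∀ p, p.Prime → p ∣ a → p ≤ K) : ∃ u v, u * v = a ∧ u ≤ K ∧ v ≤ K := by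
  have hex : ∃ u, (u ∣ a ∧ u ≤ K) ∧ ∀ w, w ∣ a ∧ w ≤ K → w ≤ u :=
    ⟨Nat.findGreatest (fun u => u ∣ a ∧ u ≤ K) K,
      Nat.findGreatest_spec (P := fun u => u ∣ a ∧ u ≤ K) hK ⟨one_dvd a, hK⟩,
      fun w hw => Nat.le_findGreatest hw.2 hw⟩
  obtain ⟨u, ⟨⟨v, rfl⟩, huK⟩, hmax⟩ := hex
  refine ⟨u, v, rfl, huK, ?_⟩
  by_contra! hv
  obtain ⟨p, hpp, w, rfl⟩ := Nat.exists_prime_and_dvd (n := v) (by omega)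
  have hpu : p ≤ u := hmax p ⟨⟨u * w, by ring⟩, hp p hpp ⟨u * w, by ring⟩⟩
  have hup : K < u * p := by
    by_contra! h
    have h1 := hmax (u * p) ⟨⟨w, by ring⟩, h⟩
    have h2 := Nat.mul_le_mul_left u hpp.two_le
    have h3 : 0 < u := Nat.pos_of_mul_pos_right ha0
    omega
  have h1 : K + 1 ≤ u ^ 2 := by nlinarith
  have h2 : (K + 1) ^ 3 ≤ n ^ 2 := by
    calc (K + 1) ^ 3 = (K + 1) * (K + 1) ^ 2 := by ring
      _ ≤ u ^ 2 * (p * w) ^ 2 := Nat.mul_le_mul h1 (Nat.pow_le_pow_left hv 2)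
      _ = (u * (p * w)) ^ 2 := by ring
      _ ≤ n ^ 2 := Nat.pow_le_pow_left ha 2
  omega

theorem card_smooth_part_le {n K : ℕ} (hK : 1 ≤ K) (hn : n ^ 2 < (K + 1) ^ 3) {A : Set ℕ}
    (hA : A ∈ gammaFamily 9 3) {B : Finset ℕ} (hBA : ∀ a ∈ B, a ∈ A) (hBn : ∀ a ∈ B, a ≤ n)
    (hB : ∀ a ∈ B, ∀ p, p.Prime → p ∣ a → p ≤ K) :
    B.card ≤ (Nat.log 2 n + 1) * (16 * K) := by
  have hfac : ∀ a ∈ B, ∃ e : ℕ × ℕ, e.1 * e.2 = a ∧ e.1 ≤ K ∧ e.2 ≤ K := by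
    intro a ha
    obtain ⟨u, v, h⟩ := exists_factorization_le hK hn (hA.1 a (hBA a ha)) (hBn a ha) (hB a ha)
    exact ⟨(u, v), h⟩
  choose! g hg using hfac
  have hBsum := Finset.card_eq_sum_card_fiberwise (f := fun a => Nat.log 2 (g a).1) (s := B)
    (t := Finset.range (Nat.log 2 n + 1)) (by
      intro a ha
      have hle : (g a).1 ≤ n :=
        (Nat.le_of_dvd (hA.1 a (hBA a ha)) ⟨_, (hg a ha).1.symm⟩).trans (hBn a ha)
      have := Nat.log_mono_right (b := 2) hle
      exact Finset.mem_coe.2 (Finset.mem_range.2 (Nat.lt_succ_of_le this)))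
  rw [hBsum]
  refine (Finset.sum_le_card_nsmul _ _ (16 * K) fun j _ => ?_).trans (by simp)
  set Bj := B.filter fun a => Nat.log 2 (g a).1 = j with hBj
  have hmem : ∀ {a}, a ∈ Bj → a ∈ B ∧ Nat.log 2 (g a).1 = j := fun h => Finset.mem_filter.1 h
  set E := Bj.image g with hEdef
  have hgE : ∀ e ∈ E, e.1 * e.2 ∈ Bj ∧ g (e.1 * e.2) = e := by
    intro e he
    obtain ⟨a, ha, rfl⟩ := Finset.mem_image.1 he
    rw [(hg a (hmem ha).1).1]
    exact ⟨ha, rfl⟩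
  have hcardE : E.card = Bj.card := by
    refine Finset.card_image_of_injOn fun a ha b hb h => ?_
    rw [← (hg a (hmem ha).1).1, ← (hg b (hmem hb).1).1, h]
  have hEA : ∀ e ∈ E, e.1 * e.2 ∈ A := fun e he => hBA _ (hmem (hgE e he).1).1
  have hinj : Set.InjOn (fun e : ℕ × ℕ => e.1 * e.2) E := by
    intro e he f hf h
    rw [← (hgE e he).2, ← (hgE f hf).2]
    exact congrArg g h
  have hEsub : E ⊆ Finset.Ico (2 ^ j) (2 ^ (j + 1)) ×ˢ Finset.Icc 1 (min K (n / 2 ^ j)) := by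
    intro e he
    obtain ⟨hab, hge⟩ := hgE e he
    obtain ⟨haB, hlog⟩ := hmem hab
    rw [hge] at hlog
    have hpos := hA.1 _ (hEA e he)
    have h1 : 0 < e.1 := Nat.pos_of_mul_pos_right hpos
    have h2 : 0 < e.2 := Nat.pos_of_mul_pos_left hpos
    have hK2 := (hg _ haB).2.2
    rw [hge] at hK2
    have hlow : 2 ^ j ≤ e.1 := hlog ▸ Nat.pow_log_le_self 2 h1.ne'
    have hupp : e.1 < 2 ^ (j + 1) := hlog ▸ Nat.lt_pow_succ_log_self (by norm_num) e.1
    rw [Finset.mem_product, Finset.mem_Ico, Finset.mem_Icc, le_min_iff,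
      Nat.le_div_iff_mul_le (by positivity)]
    refine ⟨⟨hlow, hupp⟩, h2, hK2, ?_⟩
    calc e.2 * 2 ^ j ≤ e.2 * e.1 := Nat.mul_le_mul_left _ hlow
      _ = e.1 * e.2 := mul_comm _ _
      _ ≤ n := hBn _ haB
  rw [← hcardE]
  rcases E.eq_empty_or_nonempty with h0 | ⟨e, he⟩
  · simp [h0]
  have hjK : 2 ^ j ≤ K := by
    obtain ⟨hab, hge⟩ := hgE e he
    have hK1 := (hg _ (hmem hab).1).2.1
    rw [hge] at hK1
    exact (Finset.mem_Ico.1 (Finset.mem_product.1 (hEsub he)).1).1.trans hK1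
  have hmain := card_pow_three_le hEsub (quadrilateral_free_of_mem_gammaFamily hA hEA)
    (hexagon_free_of_mem_gammaFamily hA hEA hinj)
  rw [Nat.card_Ico, Nat.card_Icc, Nat.add_sub_cancel, pow_succ,
    show 2 ^ j * 2 - 2 ^ j = 2 ^ j by omega] at hmain
  -- More than `16 K ≥ 8 (K + 1)` edges meet both degree conditions, and then `512 (K + 1)³ ≤ 128
  -- n²`, which is false.
  by_contra! hlarge
  have hcube := hmain (by omega) (by have := min_le_left K (n / 2 ^ j); omega)
  have hprod : 2 ^ j * min K (n / 2 ^ j) ≤ n :=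
    (Nat.mul_le_mul_left _ (min_le_right _ _)).trans (Nat.mul_div_le n _)
  have h1 : E.card ^ 3 ≤ 128 * n ^ 2 :=
    hcube.trans (Nat.mul_le_mul_left _ (Nat.pow_le_pow_left hprod 2))
  have h2 : (8 * (K + 1)) ^ 3 ≤ E.card ^ 3 := Nat.pow_le_pow_left (by omega) 3
  rw [mul_pow] at h2
  omega

theorem card_rough_part_le {n K : ℕ} (hn : n ^ 2 < (K + 1) ^ 3) {A : Set ℕ}
    (hA : A ∈ gammaFamily 9 3) {B : Finset ℕ} (hBA : ∀ a ∈ B, a ∈ A) (hBn : ∀ a ∈ B, a ≤ n)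
    (hB : ∀ a ∈ B, ∃ p, p.Prime ∧ p ∣ a ∧ K < p) :
    B.card ≤ Nat.primeCounting n + K := by
  have hfac : ∀ a ∈ B, ∃ e : ℕ × ℕ, e.1 * e.2 = a ∧ e.1.Prime ∧ K < e.1 := by
    intro a ha
    obtain ⟨p, hp, ⟨v, rfl⟩, hKp⟩ := hB a ha
    exact ⟨(p, v), rfl, hp, hKp⟩
  choose! g hg using hfac
  set E := B.image g with hEdef
  have hcardE : E.card = B.card := by
    refine Finset.card_image_of_injOn fun a ha b hb h => ?_
    rw [← (hg a ha).1, ← (hg b hb).1, h]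
  have hgE : ∀ e ∈ E, e.1 * e.2 ∈ B ∧ e.1.Prime ∧ K < e.1 := by
    intro e he
    obtain ⟨a, ha, rfl⟩ := Finset.mem_image.1 he
    rw [(hg a ha).1]
    exact ⟨ha, (hg a ha).2⟩
  have hEA : ∀ e ∈ E, e.1 * e.2 ∈ A := fun e he => hBA _ (hgE e he).1
  have hEsub : E ⊆ Nat.primesLE n ×ˢ Finset.Icc 1 (n / (K + 1)) := by
    intro e he
    obtain ⟨hab, hp, hK⟩ := hgE e he
    have h2 : 0 < e.2 := Nat.pos_of_mul_pos_left (hA.1 _ (hEA e he))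
    rw [Finset.mem_product, Finset.mem_Icc, Nat.mem_primesLE,
      Nat.le_div_iff_mul_le (by positivity)]
    refine ⟨⟨(Nat.le_mul_of_pos_right _ h2).trans (hBn _ hab), hp⟩, h2, ?_⟩
    calc e.2 * (K + 1) ≤ e.2 * e.1 := Nat.mul_le_mul_left _ hK
      _ = e.1 * e.2 := mul_comm _ _
      _ ≤ n := hBn _ hab
  have hmain := card_le_of_quadrilateral_free hEsub (quadrilateral_free_of_mem_gammaFamily hA hEA)
  rw [Nat.primesLE_card_eq_primeCounting, Nat.card_Icc, Nat.add_sub_cancel, hcardE] at hmain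
  -- `(n / (K + 1))² < K + 1` follows from `n² < (K + 1)³`.
  refine hmain.trans (Nat.add_le_add_left (Nat.lt_succ_iff.1 ?_) _)
  refine Nat.lt_of_mul_lt_mul_right (a := (K + 1) ^ 2) ?_
  calc (n / (K + 1)) ^ 2 * (K + 1) ^ 2 = (n / (K + 1) * (K + 1)) ^ 2 := by ring
    _ ≤ n ^ 2 := Nat.pow_le_pow_left (Nat.div_mul_le_self n _) 2
    _ < (K + 1) ^ 3 := hn
    _ = (K + 1) * (K + 1) ^ 2 := by ring

theorem fMax_le {n K : ℕ} (hK : 1 ≤ K) (hn : n ^ 2 < (K + 1) ^ 3) :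
    fMax 9 3 n ≤ Nat.primeCounting n + K + (Nat.log 2 n + 1) * (16 * K) := by
  classical
  unfold fMax
  refine Finset.sup_le fun A hA => ?_
  obtain ⟨hAn, hγ⟩ := Finset.mem_filter.1 hA
  have hle : ∀ a ∈ A, a ≤ n := fun a ha =>
    (Finset.mem_Icc.1 (Finset.mem_powerset.1 hAn ha)).2
  rw [← Finset.card_filter_add_card_filter_not (fun a => ∃ p, p.Prime ∧ p ∣ a ∧ K < p)]
  refine Nat.add_le_add
    (card_rough_part_le hn hγ (fun a ha => (Finset.mem_filter.1 ha).1)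
      (fun a ha => hle a (Finset.mem_filter.1 ha).1) fun a ha => (Finset.mem_filter.1 ha).2)
    (card_smooth_part_le hK hn hγ (fun a ha => (Finset.mem_filter.1 ha).1)
      (fun a ha => hle a (Finset.mem_filter.1 ha).1) fun a ha p hp hpa => ?_)
  by_contra! h
  exact (Finset.mem_filter.1 ha).2 ⟨p, hp, hpa, h⟩

theorem upper_bound :
    ∃ C : ℝ, 0 < C ∧ ∀ n : ℕ, 2 ≤ n →
      (fMax 9 3 n : ℝ) - (Nat.primeCounting n : ℝ) ≤ C * ((n : ℝ) ^ (2 / 3 : ℝ) * Real.log n) := by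
  -- `66 = 2 + 4 * 16`: 2 from the summand `K`, the rest from the dyadic classes.
  refine ⟨66, by norm_num, fun n hn => ?_⟩
  have hn' : (2 : ℝ) ≤ n := by exact_mod_cast hn
  set T : ℝ := (n : ℝ) ^ (2 / 3 : ℝ) with hT
  have hT1 : 1 ≤ T := Real.one_le_rpow (by linarith) (by norm_num)
  have hT3 : T ^ 3 = (n : ℝ) ^ 2 := by
    rw [hT, ← Real.rpow_natCast, ← Real.rpow_mul (by positivity), ← Real.rpow_natCast]
    norm_num
  have hK1 : 1 ≤ ⌊T⌋₊ := Nat.one_le_floor_iff T |>.2 hT1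
  have hK : n ^ 2 < (⌊T⌋₊ + 1) ^ 3 := by
    have : (n : ℝ) ^ 2 < (⌊T⌋₊ + 1 : ℝ) ^ 3 := by
      rw [← hT3]
      exact pow_lt_pow_left₀ (Nat.lt_floor_add_one T) (by linarith) (by norm_num)
    exact_mod_cast this
  have hmain : (fMax 9 3 n : ℝ) ≤
      Nat.primeCounting n + ⌊T⌋₊ + (Nat.log 2 n + 1) * (16 * ⌊T⌋₊) := by
    exact_mod_cast fMax_le hK1 hK
  have hfloor : (⌊T⌋₊ : ℝ) ≤ T := Nat.floor_le (by linarith)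
  have hlog2 := Real.log_two_gt_d9
  have hlogn : Real.log 2 ≤ Real.log n := Real.log_le_log (by norm_num) hn'
  have hlog : (Nat.log 2 n : ℝ) ≤ 2 * Real.log n := by
    have h1 : (Nat.log 2 n : ℝ) * Real.log 2 ≤ Real.log n := by
      rw [← Real.log_pow]
      refine Real.log_le_log (by positivity) ?_
      exact_mod_cast Nat.pow_log_le_self 2 (by omega : n ≠ 0)
    nlinarith [Nat.cast_nonneg (α := ℝ) (Nat.log 2 n)]
  have h2 : ((Nat.log 2 n : ℝ) + 1) * (16 * ⌊T⌋₊) ≤ (4 * Real.log n) * (16 * T) := by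
    gcongr
    linarith
  have h3 : T ≤ 2 * (T * Real.log n) := by nlinarith
  linarith

theorem mainTheorem10 :
    ∃ c C : ℝ, 0 < c ∧ 0 < C ∧ ∀ n : ℕ, 2 ≤ n →
      c * ((n : ℝ) ^ (2 / 3 : ℝ) / Real.log n ^ (4 / 3 : ℝ))
          ≤ (fMax 9 3 n : ℝ) - (Nat.primeCounting n : ℝ) ∧
      (fMax 9 3 n : ℝ) - (Nat.primeCounting n : ℝ)
          ≤ C * ((n : ℝ) ^ (2 / 3 : ℝ) * Real.log n) := by
  obtain ⟨c, hc, hlower⟩ := lower_bound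
  obtain ⟨C, hC, hupper⟩ := upper_bound
  exact ⟨c, C, hc, hC, fun n hn => ⟨hlower n hn, hupper n hn⟩⟩
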